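/- Let $(\Omega,\mathcal F,\mathbb P)$ be a probability space with an ergodic measure-preserving action $(\pi_j)_{j\in\mathbf Z}$ of the group $\mathbf Z$, and let $0<\gamma\le 1$. Let $d_i(\omega)=d(i,\omega)\in\mathbf R$ and $f(i,s;\omega)\in\mathbf R$ ($i\in\mathbf Z$, $s\in[0,1]$, $\omega\in\Omega$) be random variables, i.e. measurable in $\omega$, such that for almost every $\omega$: $0<\inf_i d_i(\omega)\le\sup_i d_i(\omega)<\infty$; $f(i,\cdot;\omega)\in C^{1+\gamma}([0,1])$ with norms bounded uniformly in $i$; $f(i,0;\omega)=f(i,1;\omega)=0$ for all $i$; $0<\inf_{i'} f(i',s;\omega)\le f(i,s;\omega)\le c_i(\omega)s$ for all $i$ and all $s\in(0,1)$, where $c_i(\omega):=f'_s(i,0;\omega)$; and $\liminf_{|i|\to\infty}\bigl(c_i(\omega)-(\sqrt{d_{i+1}(\omega)}-\sqrt{d_i(\omega)})^2\bigr)>0$. Assume that $c$ and $d$ are stationary: for almost every $\omega$, $c_{i+j}(\omega)=c_i(\pi_j\omega)$ and $d_{i+j}(\omega)=d_i(\pi_j\omega)$ for all $i,j\in\mathbf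 Z$. For $\phi:\mathbf Z\to\mathbf R$ and $p\in\mathbf R$ put $$(\mathcal L^\omega\phi)_i=d_{i+1}(\omega)(\phi_{i+1}-\phi_i)+d_i(\omega)(\phi_{i-1}-\phi_i)+c_i(\omega)\phi_i,\qquad (L_p^\omega\phi)_i=e^{-pi}\bigl(\mathcal L^\omega(e^{p\cdot}\phi)\bigr)_i .$$ Let $\mathcal A_{-\infty}$ be the set of $\phi:\mathbf Z\to(0,\infty)$ such that $\lim_{|i|\to\infty}\frac{\ln\phi_i}{i}=0$ and the sequences $\bigl(\frac{\phi_{i\pm1}-\phi_i}{\phi_i}\bigr)_{i\in\mathbf Z}$ are bounded, and let $$\underline{\lambda_1}(p,-\infty;\omega)=\sup\{\lambda\in\mathbf R:\ \exists\,\phi\in\mathcal A_{-\infty},\ (L_p^\omega\phi)_i\ge\lambda\phi_i\ \text{for all } i\in\mathbf Z\}.$$ For $l\in\mathbf Z$ and $k\ge1$ let $\Gamma_{l,k}(\omega)$ be the Dirichlet principal eigenvalue of $\mathcal L^\omega$ on $\{l+1,\dots,l+k\}$, i.e. the number $\lambda$ for which there is $\phi$ with $\phi_l=\phi_{l+k+1}=0$,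 and $\phi_i>0$, $(\mathcal L^\omega\phi)_i=\lambda\phi_i$ for $l+1\le i\le l+k$. Then there is a constant $\Gamma_\infty\in\mathbf R$ such that, almost surely, $$\lim_{k\to\infty}\Gamma_{-k,2k}(\omega)=\lim_{k\to\infty}\Gamma_{-k,k}(\omega)=\lim_{k\to\infty}\Gamma_{0,k}(\omega)=\Gamma_\infty,$$ and there is a measurable set $\Omega''\subset\Omega$ with $\mathbb P(\Omega'')=1$ such that $\underline{\lambda_1}(p,-\infty;\omega)\ge\Gamma_\infty$ for every $\omega\in\Omega''$ and every $p\in\mathbf R$. -/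

import Mathlib

open MeasureTheory Filter Topology Set

noncomputable section

namespace KPPLattice

/-- The diffusion operator `(A φ)_i = d_{i+1} (φ_{i+1} - φ_i) + d_i (φ_{i-1} - φ_i)`. -/
def diffusion (d : ℤ → ℝ) (φ : ℤ → ℝ) (i : ℤ) : ℝ :=
  d (i + 1) * (φ (i + 1) - φ i) + d i * (φ (i - 1) - φ i)

/-- The linearized operator `(ℒ φ)_i = (A φ)_i + c_i φ_i`. -/
def linOp (d c : ℤ → ℝ) (φ : ℤ → ℝ) (i : ℤ) : ℝ :=
  diffusion d φ i + c i * φ i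

/-- The conjugated operator `(L_p φ)_i = e^{-p i} (ℒ (e^{p ·} φ))_i`. -/
def twistedOp (d c : ℤ → ℝ) (p : ℝ) (φ : ℤ → ℝ) (i : ℤ) : ℝ :=
  Real.exp (-p * i) * linOp d c (fun j : ℤ => Real.exp (p * j) * φ j) i

/-- The set `𝒜_{-∞}` of admissible test functions on the whole lattice. -/
def admissible : Set (ℤ → ℝ) :=
  {φ | (∀ i, 0 < φ i) ∧
    Tendsto (fun i : ℤ => Real.log (φ i) / (i : ℝ)) cofinite (𝓝 0) ∧
    Memℓp (fun i : ℤ => (φ (i + 1) - φ i) / φ i) ⊤ ∧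
    Memℓp (fun i : ℤ => (φ (i - 1) - φ i) / φ i) ⊤}

/-- The lower generalized principal eigenvalue of `L_p` on the whole lattice: the supremum
(taken in the extended reals) of the `λ` for which some admissible `φ` satisfies
`(L_p φ)_i ≥ λ φ_i` for every `i`. -/
def lowerEigenvalue (d c : ℤ → ℝ) (p : ℝ) : EReal :=
  sSup ((fun r : ℝ => (r : EReal)) ''
    {r : ℝ | ∃ φ ∈ admissible, ∀ i : ℤ, r * φ i ≤ twistedOp d c p φ i})

/-- `(r, φ)` is a principal eigenpair of `ℒ` on `{l + 1, …, l + k}` with Dirichlet conditions at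
`l` and `l + k + 1`: an eigenpair whose eigenfunction is positive on `{l + 1, …, l + k}`. -/
def IsPrincipalEigenpair (d c : ℤ → ℝ) (l : ℤ) (k : ℕ) (r : ℝ) (φ : ℤ → ℝ) : Prop :=
  (∀ i ∈ Icc (l + 1) (l + k), 0 < φ i ∧ linOp d c φ i = r * φ i) ∧
    φ l = 0 ∧ φ (l + k + 1) = 0

/-- The Dirichlet principal eigenvalue on `{l + 1, …, l + k}`. When `k ≥ 1` and all
`d_i` are positive the set below has exactly one element, by the Perron-Frobenius theorem. -/
def dirichletEigenvalue (d c : ℤ → ℝ) (l : ℤ) (k : ℕ) : ℝ :=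
  sSup {r : ℝ | ∃ φ : ℤ → ℝ, IsPrincipalEigenpair d c l k r φ}

/-- The linearized reaction rate `c_i = f'_s(i, 0)`, a one-sided derivative as `f(i, ·)` lives on
`[0, 1]`. -/
def linRate (f : ℤ → ℝ → ℝ) (i : ℤ) : ℝ :=
  derivWithin (f i) (Icc 0 1) 0

/-- The functions `f(i, ·)` belong to `C^{1+γ}([0, 1])` with norms bounded uniformly in `i`. -/
def UniformC1Holder (γ : ℝ) (f : ℤ → ℝ → ℝ) : Prop :=
  (∀ i, DifferentiableOn ℝ (f i) (Icc 0 1)) ∧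
  ∃ K : ℝ, ∀ i, ∀ s ∈ Icc (0 : ℝ) 1,
    |f i s| ≤ K ∧ |derivWithin (f i) (Icc 0 1) s| ≤ K ∧
    ∀ t ∈ Icc (0 : ℝ) 1,
      |derivWithin (f i) (Icc 0 1) s - derivWithin (f i) (Icc 0 1) t| ≤ K * |s - t| ^ γ

/-- The conditions on one realization of the coefficients: diffusion rates `d_i` and a reaction
term `f(i, s)` of KPP type.
(`0 < ⨅ i, x i` also says that `x` is bounded below, the infimum of an unbounded set being `0`.) -/
structure IsKPPMedium (γ : ℝ) (d : ℤ → ℝ) (f : ℤ → ℝ → ℝ) : Prop where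
  inf_d_pos : 0 < ⨅ i, d i
  sup_d_lt : BddAbove (range d)
  smooth : UniformC1Holder γ f
  zero_left : ∀ i, f i 0 = 0
  zero_right : ∀ i, f i 1 = 0
  inf_f_pos : ∀ s ∈ Ioo (0 : ℝ) 1, 0 < ⨅ i, f i s
  le_linear : ∀ i, ∀ s ∈ Ioo (0 : ℝ) 1, f i s ≤ linRate f i * s
  liminf_pos : 0 < liminf
    (fun i : ℤ => linRate f i - (Real.sqrt (d (i + 1)) - Real.sqrt (d i)) ^ 2) cofinite

end KPPLattice

end

/-! `Γinf` is the supremum of the levels `r` that some box of fixed length reaches with positive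
probability, in the sense `P {ω | r ≤ Γ 0 k ω} ≠ 0`. By ergodicity such a box recurs along almost
every orbit in both directions. The Dirichlet eigenvalue grows with the box, so all three eigenvalue
sequences eventually exceed `r`. A level that is not reached bounds every box almost surely, by
stationarity. Hence the limits.

For the lower bound on the generalized eigenvalue, fix `r < s < Γinf`. Boxes of a fixed length `k`
with eigenvalue at least `s` occur with sublinear gaps (`ae_sublinear_dist`, from Kac's lemma and
Borel–Cantelli). Each Dirichlet eigenfunction, extended by zero, is a compactly supported
subsolution at rate `s`; the margin `s - r` pays for adding an exponential tail of steep rate `K`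
(`exists_tail_subsolution`). Summing these bumps, centred at `y` and weighted by `exp (p * y)`, and
multiplying the sum by `exp (-p * i)` gives a bounded positive subsolution of the twisted operator.
Sublinear gaps make its logarithm `o(|i|)`, so it is admissible for every `p` (`exists_admissible`).
-/

namespace KPPLattice

/-! ### Dirichlet principal eigenvalues by shooting -/

/-- The solution of `ℒ φ = r φ` to the right of `l` with `φ_l = 0`, `φ_{l+1} = 1`; the value at
`n` is `φ_{l+n}`. -/
noncomputable def shoot (d c : ℤ → ℝ) (l : ℤ) (r : ℝ) : ℕ → ℝ
  | 0 => 0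
  | 1 => 1
  | n + 2 => ((r - c (l + n + 1) + d (l + n + 2) + d (l + n + 1)) * shoot d c l r (n + 1)
      - d (l + n + 1) * shoot d c l r n) / d (l + n + 2)

section Dirichlet

variable {d c : ℤ → ℝ} {l : ℤ} {k : ℕ} {r s : ℝ} {φ ψ : ℤ → ℝ}

theorem shoot_rec (hd : ∀ i, 0 < d i) (n : ℕ) :
    d (l + n + 2) * shoot d c l r (n + 2) =
      (r - c (l + n + 1) + d (l + n + 2) + d (l + n + 1)) * shoot d c l r (n + 1)
      - d (l + n + 1) * shoot d c l r n := by
  have := (hd (l + n + 2)).ne'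
  rw [shoot]
  field_simp

theorem continuous_shoot (d c : ℤ → ℝ) (l : ℤ) (n : ℕ) :
    Continuous fun r => shoot d c l r n := by
  induction n using Nat.twoStepInduction with
  | zero => simpa [shoot] using continuous_const
  | one => simpa [shoot] using continuous_const
  | more n h0 h1 =>
    simp only [shoot]
    fun_prop

theorem measurable_shoot {Ω : Type*} [MeasurableSpace Ω] {d c : ℤ → Ω → ℝ}
    (hd : ∀ i, Measurable (d i)) (hc : ∀ i, Measurable (c i)) (l : ℤ) (r : ℝ) (n : ℕ) :
    Measurable fun ω => shoot (fun i => d i ω) (fun i => c i ω) l r n := by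
  induction n using Nat.twoStepInduction with
  | zero => simp [shoot]
  | one => simp [shoot]
  | more n h0 h1 =>
    simp only [shoot]
    fun_prop

/-- The discrete Green identity against a Dirichlet eigenfunction. -/
theorem green (h : IsPrincipalEigenpair d c l k r φ) (ψ : ℤ → ℝ) :
    ∑ n ∈ Finset.range k, φ (l + n + 1) * (linOp d c ψ (l + n + 1) - r * ψ (l + n + 1)) =
      d (l + k + 1) * φ (l + k) * ψ (l + k + 1) + d (l + 1) * φ (l + 1) * ψ l := by
  -- The discrete Wronskian: each summand is one of its increments, and `φ` vanishing at both ends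
  -- leaves a single boundary term at each.
  let W : ℕ → ℝ := fun m =>
    d (l + m + 1) * (φ (l + m) * ψ (l + m + 1) - φ (l + m + 1) * ψ (l + m))
  have key : ∀ n ∈ Finset.range k,
      φ (l + n + 1) * (linOp d c ψ (l + n + 1) - r * ψ (l + n + 1)) =
        W (n + 1) - W n := by
    intro n hn
    have hn := Finset.mem_range.1 hn
    have he := (h.1 (l + n + 1) ⟨by omega, by omega⟩).2
    simp only [linOp, diffusion, W] at he ⊢
    have e1 : l + (n : ℤ) + 1 - 1 = l + n := by ring
    push_cast
    rw [e1] at he ⊢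
    rw [← add_assoc l]
    linear_combination ψ (l + n + 1) * he
  rw [Finset.sum_congr rfl key, Finset.sum_range_sub]
  simp [W, h.2.1, h.2.2]
  ring

theorem mem_box (i : ℤ) : i ∈ Icc (l + 1) (l + k) ↔ ∃ n < k, i = l + (n : ℕ) + 1 := by
  constructor
  · rintro ⟨h1, h2⟩
    exact ⟨(i - l - 1).toNat, by omega, by omega⟩
  · rintro ⟨n, hn, rfl⟩
    exact ⟨by omega, by omega⟩

/-- If `r < s`, the Green sum against `φ` would be positive, while its boundary terms vanish. -/
theorem le_of_subsolution (h : IsPrincipalEigenpair d c l k r φ)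
    (hl : ψ l = 0) (hr : ψ (l + k + 1) = 0) (h0 : ∀ i ∈ Icc (l + 1) (l + k), 0 ≤ ψ i)
    (hpos : ∃ i ∈ Icc (l + 1) (l + k), 0 < ψ i)
    (hsub : ∀ i ∈ Icc (l + 1) (l + k), s * ψ i ≤ linOp d c ψ i) : s ≤ r := by
  by_contra! hrs
  obtain ⟨i, hi, hi0⟩ := hpos
  obtain ⟨m, hm, rfl⟩ := (mem_box i).1 hi
  have hg := green h ψ
  rw [hl, hr, mul_zero, mul_zero, add_zero] at hg
  have hle : ∀ n ∈ Finset.range k, (s - r) * (φ (l + n + 1) * ψ (l + n + 1)) ≤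
      φ (l + n + 1) * (linOp d c ψ (l + n + 1) - r * ψ (l + n + 1)) := by
    intro n hn
    have hb := (mem_box (l := l) (k := k) (l + n + 1)).2 ⟨n, Finset.mem_range.1 hn, rfl⟩
    have := mul_le_mul_of_nonneg_left (hsub _ hb) (h.1 _ hb).1.le
    linarith
  have hsum := Finset.sum_le_sum hle
  rw [hg] at hsum
  have : 0 < ∑ n ∈ Finset.range k, (s - r) * (φ (l + n + 1) * ψ (l + n + 1)) := by
    refine Finset.sum_pos' (fun n hn => ?_) ⟨m, Finset.mem_range.2 hm, ?_⟩
    · have hb := (mem_box (l := l) (k := k) (l + n + 1)).2 ⟨n, Finset.mem_range.1 hn, rfl⟩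
      exact mul_nonneg (sub_pos.2 hrs).le (mul_nonneg (h.1 _ hb).1.le (h0 _ hb))
    · exact mul_pos (sub_pos.2 hrs) (mul_pos (h.1 _ hi).1 hi0)
  linarith

/-- The strictness comes from the right boundary term of Green's identity, which is positive. -/
theorem lt_of_supersolution (hd : ∀ i, 0 < d i) (hk : 1 ≤ k)
    (h : IsPrincipalEigenpair d c l k r φ)
    (hl : ψ l = 0) (hr : 0 < ψ (l + k + 1)) (h0 : ∀ i ∈ Icc (l + 1) (l + k), 0 < ψ i)
    (hsup : ∀ i ∈ Icc (l + 1) (l + k), linOp d c ψ i ≤ s * ψ i) : r < s := by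
  by_contra! hrs
  have hg := green h ψ
  rw [hl, mul_zero, add_zero] at hg
  have hpos : 0 < d (l + k + 1) * φ (l + k) * ψ (l + k + 1) :=
    mul_pos (mul_pos (hd _) (h.1 _ ⟨by omega, by omega⟩).1) hr
  have : ∑ n ∈ Finset.range k, φ (l + n + 1) *
      (linOp d c ψ (l + n + 1) - r * ψ (l + n + 1)) ≤ 0 := by
    refine Finset.sum_nonpos fun n hn => ?_
    have hb := (mem_box (l := l) (k := k) (l + n + 1)).2 ⟨n, Finset.mem_range.1 hn, rfl⟩
    refine mul_nonpos_of_nonneg_of_nonpos (h.1 _ hb).1.le ?_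
    have := hsup _ hb
    have := mul_le_mul_of_nonneg_right hrs (h0 _ hb).le
    linarith
  linarith

theorem linOp_shoot (hd : ∀ i, 0 < d i) (n : ℕ) {χ : ℤ → ℝ}
    (h0 : χ (l + n) = shoot d c l r n) (h1 : χ (l + n + 1) = shoot d c l r (n + 1)) :
    linOp d c χ (l + n + 1) = r * χ (l + n + 1) +
      d (l + n + 2) * (χ (l + n + 2) - shoot d c l r (n + 2)) := by
  have := shoot_rec (l := l) (r := r) (c := c) hd n
  have e1 : l + (n : ℤ) + 1 - 1 = l + n := by ring
  have e2 : l + (n : ℤ) + 1 + 1 = l + n + 2 := by ring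
  simp only [linOp, diffusion, e1, e2, h0, h1]
  linear_combination this

theorem linOp_shoot_eq (hd : ∀ i, 0 < d i) (n : ℕ) :
    linOp d c (fun i => shoot d c l r (i - l).toNat) (l + n + 1) =
      r * shoot d c l r (n + 1) := by
  rw [linOp_shoot (r := r) hd n (by simp) (by congr 1; omega)]
  have e1 : (l + (n : ℤ) + 1 - l).toNat = n + 1 := by omega
  have e2 : (l + (n : ℤ) + 2 - l).toNat = n + 2 := by omega
  simp [e1, e2]

/-- For `r` above `c`, the flux `d (φ_{i+1} - φ_i)` does not decrease, so the shooting solution is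
nondecreasing. -/
theorem shoot_pos_of_large (hd : ∀ i, 0 < d i) (hr : ∀ n < k, c (l + n + 1) ≤ r) :
    ∀ n ≤ k, 0 < shoot d c l r (n + 1) ∧ shoot d c l r n ≤ shoot d c l r (n + 1) := by
  intro n
  induction n with
  | zero => simp [shoot]
  | succ n ih =>
    intro hn
    obtain ⟨h1, h2⟩ := ih (by omega)
    have hrec := shoot_rec (l := l) (r := r) (c := c) hd n
    have hc := hr n (by omega)
    have : 0 ≤ d (l + n + 2) * (shoot d c l r (n + 2) - shoot d c l r (n + 1)) := by
      have e : d (l + n + 2) * (shoot d c l r (n + 2) - shoot d c l r (n + 1)) =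
        (r - c (l + n + 1)) * shoot d c l r (n + 1) +
          d (l + n + 1) * (shoot d c l r (n + 1) - shoot d c l r n) := by
        linear_combination hrec
      rw [e]
      exact add_nonneg (mul_nonneg (sub_nonneg.2 hc) h1.le)
        (mul_nonneg (hd _).le (sub_nonneg.2 h2))
    have := nonneg_of_mul_nonneg_right this (hd _)
    exact ⟨by linarith, by linarith⟩

/-- The eigenvalue is the infimum of the open set of `r` whose shooting solution is positive up to
the right end. At the infimum all values are nonnegative; an interior zero after a positive value
would make the next value negative, so only the last value can vanish. -/
theorem exists_shoot_eigenvalue (hd : ∀ i, 0 < d i) (c : ℤ → ℝ) (l : ℤ) (hk : 1 ≤ k) :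
    ∃ r, (∀ n < k, 0 < shoot d c l r (n + 1)) ∧ shoot d c l r (k + 1) = 0 := by
  set U : Set ℝ := {r | ∀ n ∈ Finset.range (k + 1), 0 < shoot d c l r (n + 1)} with hU
  have hopen : IsOpen U := by
    have : U = ⋂ n ∈ Finset.range (k + 1), {r | 0 < shoot d c l r (n + 1)} := by
      ext; simp [hU]
    rw [this]
    exact isOpen_biInter_finset fun n _ => isOpen_lt continuous_const (continuous_shoot d c l _)
  have hne : U.Nonempty := by
    obtain ⟨R, hR⟩ := ((Finset.range k).image fun n : ℕ => c (l + n + 1)).exists_le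
    refine ⟨R, fun n hn => (shoot_pos_of_large (k := k) hd (fun m hm => hR _ ?_) n ?_).1⟩
    · exact Finset.mem_image_of_mem _ (Finset.mem_range.2 hm)
    · exact Nat.lt_succ_iff.1 (Finset.mem_range.1 hn)
  have hbdd : BddBelow U := by
    refine ⟨c (l + 1) - d (l + 2) - d (l + 1), fun r hr => ?_⟩
    have h1 := hr 1 (by simp; omega)
    have hrec := shoot_rec (l := l) (r := r) (c := c) hd 0
    have h2 := mul_pos (hd (l + 2)) h1
    rw [zero_add] at hrec
    simp only [Nat.cast_zero, add_zero] at hrec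
    rw [hrec] at h2
    simp only [shoot] at h2
    linarith
  refine ⟨sInf U, ?_⟩
  set r := sInf U
  have hnot : r ∉ U := fun h => by
    obtain ⟨ε, hε, hb⟩ := Metric.isOpen_iff.1 hopen r h
    have : r - ε / 2 ∈ U := hb (by simp [abs_of_pos hε, hε])
    have := csInf_le hbdd this
    linarith
  have hcl : ∀ n ≤ k, 0 ≤ shoot d c l r (n + 1) := by
    intro n hn
    have hmem : r ∈ closure U := csInf_mem_closure hne hbdd
    have hsub : U ⊆ {r | 0 ≤ shoot d c l r (n + 1)} := fun x hx =>
      (hx n (by simp; omega)).le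
    exact (isClosed_le continuous_const (continuous_shoot d c l _)).closure_subset_iff.2 hsub hmem
  have hpos : ∀ n < k, 0 < shoot d c l r (n + 1) := by
    intro n
    induction n with
    | zero => simp [shoot]
    | succ n ih =>
      intro hn
      refine lt_of_le_of_ne (hcl _ hn.le) fun h0 => ?_
      have h1 := mul_pos (hd (l + n + 2)) (ih (by omega))
      have h2 := hcl (n + 2) (by omega)
      have hrec := shoot_rec (l := l) (r := r) (c := c) hd (n + 1)
      rw [← h0, mul_zero, zero_sub] at hrec
      have h3 := mul_nonneg (hd (l + (n + 1 : ℕ) + 2)).le h2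
      have e : l + ((n + 1 : ℕ) : ℤ) + 1 = l + n + 2 := by push_cast; ring
      rw [e] at hrec
      linarith
  refine ⟨hpos, le_antisymm ?_ (hcl k le_rfl)⟩
  by_contra! h
  refine hnot fun n hn => ?_
  rcases Nat.lt_or_ge n k with h' | h'
  · exact hpos n h'
  · obtain rfl : n = k := by simp at hn; omega
    exact h

theorem isPrincipalEigenpair_shoot (hd : ∀ i, 0 < d i)
    (hpos : ∀ n < k, 0 < shoot d c l r (n + 1)) (hend : shoot d c l r (k + 1) = 0) :
    IsPrincipalEigenpair d c l k r fun i => shoot d c l r (i - l).toNat := by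
  refine ⟨fun i hi => ?_, by simp [shoot], ?_⟩
  · obtain ⟨n, hn, rfl⟩ := (mem_box i).1 hi
    have e : (l + (n : ℤ) + 1 - l).toNat = n + 1 := by omega
    simp only [e]
    exact ⟨hpos n hn, linOp_shoot_eq hd n⟩
  · have e : (l + (k : ℤ) + 1 - l).toNat = k + 1 := by omega
    simp only [e, hend]

theorem IsPrincipalEigenpair.eq (hk : 1 ≤ k) (h : IsPrincipalEigenpair d c l k r φ)
    (h' : IsPrincipalEigenpair d c l k s ψ) : r = s := by
  have hmem : l + 1 ∈ Icc (l + 1) (l + k) := ⟨le_rfl, by omega⟩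
  apply le_antisymm
  · exact le_of_subsolution h' h.2.1 h.2.2 (fun i hi => (h.1 i hi).1.le)
      ⟨l + 1, hmem, (h.1 _ hmem).1⟩ fun i hi => (h.1 i hi).2.ge
  · exact le_of_subsolution h h'.2.1 h'.2.2 (fun i hi => (h'.1 i hi).1.le)
      ⟨l + 1, hmem, (h'.1 _ hmem).1⟩ fun i hi => (h'.1 i hi).2.ge

theorem exists_isPrincipalEigenpair (hd : ∀ i, 0 < d i) (c : ℤ → ℝ) (l : ℤ) (hk : 1 ≤ k) :
    ∃ φ, IsPrincipalEigenpair d c l k (dirichletEigenvalue d c l k) φ := by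
  obtain ⟨r, hpos, hend⟩ := exists_shoot_eigenvalue hd c l hk
  have h := isPrincipalEigenpair_shoot hd hpos hend
  have hset : {r : ℝ | ∃ φ : ℤ → ℝ, IsPrincipalEigenpair d c l k r φ} = {r} := by
    ext s
    exact ⟨fun ⟨ψ, hψ⟩ => hψ.eq hk h, fun hs => ⟨_, hs ▸ h⟩⟩
  rw [dirichletEigenvalue, hset, csSup_singleton]
  exact ⟨_, h⟩

/-- A nonnegative subsolution supported in the box bounds the Dirichlet eigenvalue from below. -/
theorem le_dirichletEigenvalue (hd : ∀ i, 0 < d i) (h0 : ∀ i, 0 ≤ ψ i)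
    (hout : ∀ i ∉ Icc (l + 1) (l + k), ψ i = 0) (hpos : ∃ i, 0 < ψ i)
    (hsub : ∀ i ∈ Icc (l + 1) (l + k), s * ψ i ≤ linOp d c ψ i) :
    s ≤ dirichletEigenvalue d c l k := by
  obtain ⟨i, hi⟩ := hpos
  have hmem : i ∈ Icc (l + 1) (l + k) := by
    by_contra h
    exact hi.ne' (hout i h)
  have hk : 1 ≤ k := by
    have := hmem.1.trans hmem.2
    omega
  obtain ⟨φ, hφ⟩ := exists_isPrincipalEigenpair hd c l hk
  refine le_of_subsolution hφ (hout _ ?_) (hout _ ?_) (fun i _ => h0 i) ⟨i, hmem, hi⟩ hsub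
  · simp
  · simp

/-- The Dirichlet eigenfunction extended by zero is a subsolution on the whole lattice. -/
theorem exists_subsolution (hd : ∀ i, 0 < d i) (c : ℤ → ℝ) (l : ℤ) (hk : 1 ≤ k) :
    ∃ ψ : ℤ → ℝ, (∀ i, 0 ≤ ψ i) ∧ (∀ i ∈ Icc (l + 1) (l + k), 0 < ψ i) ∧
      (∀ i ∉ Icc (l + 1) (l + k), ψ i = 0) ∧
      ∀ i, dirichletEigenvalue d c l k * ψ i ≤ linOp d c ψ i := by
  obtain ⟨φ, hφ⟩ := exists_isPrincipalEigenpair hd c l hk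
  set ψ : ℤ → ℝ := (Icc (l + 1) (l + k)).indicator φ with hψ
  have hin : ∀ i ∈ Icc (l + 1) (l + k), ψ i = φ i := fun i hi => indicator_of_mem hi φ
  have hout : ∀ i ∉ Icc (l + 1) (l + k), ψ i = 0 := fun i hi => indicator_of_notMem hi φ
  have h0 : ∀ i, 0 ≤ ψ i := fun i => indicator_nonneg (fun i hi => (hφ.1 i hi).1.le) i
  have hcl : ∀ i ∈ Icc l (l + k + 1), ψ i = φ i := by
    intro i hi
    by_cases h : i ∈ Icc (l + 1) (l + k)
    · exact hin i h
    · rw [hout i h]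
      have : i = l ∨ i = l + k + 1 := by
        simp only [mem_Icc] at h hi
        omega
      rcases this with rfl | rfl
      · exact hφ.2.1.symm
      · exact hφ.2.2.symm
  refine ⟨ψ, h0, fun i hi => by rw [hin i hi]; exact (hφ.1 i hi).1, hout, fun i => ?_⟩
  by_cases h : i ∈ Icc (l + 1) (l + k)
  · have := (hφ.1 i h).2
    obtain ⟨h1, h2⟩ := h
    rw [hin i ⟨h1, h2⟩, ← this]
    simp only [linOp, diffusion]
    rw [hcl i ⟨by omega, by omega⟩, hcl (i + 1) ⟨by omega, by omega⟩,
      hcl (i - 1) ⟨by omega, by omega⟩]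
  · simp only [linOp, diffusion, hout i h, mul_zero, sub_zero, add_zero]
    exact add_nonneg (mul_nonneg (hd _).le (h0 _)) (mul_nonneg (hd _).le (h0 _))

theorem dirichletEigenvalue_mono (hd : ∀ i, 0 < d i) {l' : ℤ} {k' : ℕ} (hk : 1 ≤ k)
    (hl : l' ≤ l) (hr : l + k ≤ l' + k') :
    dirichletEigenvalue d c l k ≤ dirichletEigenvalue d c l' k' := by
  obtain ⟨ψ, h0, hpos, hout, hsub⟩ := exists_subsolution hd c l hk
  refine le_dirichletEigenvalue hd h0 (fun i hi => hout i fun h => hi ?_)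
    ⟨l + 1, hpos _ ⟨le_rfl, by omega⟩⟩ fun i _ => hsub i
  exact ⟨by linarith [h.1], by linarith [h.2]⟩

theorem dirichletEigenvalue_lt_of_shoot_pos (hd : ∀ i, 0 < d i) (hk : 1 ≤ k)
    (h : ∀ n ≤ k, 0 < shoot d c l r (n + 1)) : dirichletEigenvalue d c l k < r := by
  obtain ⟨φ, hφ⟩ := exists_isPrincipalEigenpair hd c l hk
  refine lt_of_supersolution (ψ := fun i => shoot d c l r (i - l).toNat) hd hk hφ
    (by simp [shoot]) ?_ ?_ ?_
  · have e : (l + (k : ℤ) + 1 - l).toNat = k + 1 := by omega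
    simpa only [e] using h k le_rfl
  · intro i hi
    obtain ⟨n, hn, rfl⟩ := (mem_box i).1 hi
    have e : (l + (n : ℤ) + 1 - l).toNat = n + 1 := by omega
    simpa only [e] using h n hn.le
  · intro i hi
    obtain ⟨n, hn, rfl⟩ := (mem_box i).1 hi
    have e : (l + (n : ℤ) + 1 - l).toNat = n + 1 := by omega
    simp only [e]
    exact (linOp_shoot_eq hd n).le

/-- Turns a level set of the eigenvalue into finitely many inequalities between explicit functions
of the coefficients, which yields measurability. If positivity first fails at `m + 1`, the shooting
solution truncated there is a subsolution at rate `r` on a smaller box, and monotonicity in the box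
concludes. -/
theorem dirichletEigenvalue_lt_iff (hd : ∀ i, 0 < d i) (hk : 1 ≤ k) :
    dirichletEigenvalue d c l k < r ↔ ∀ n ≤ k, 0 < shoot d c l r (n + 1) := by
  refine ⟨fun hr => ?_, dirichletEigenvalue_lt_of_shoot_pos hd hk⟩
  by_contra hn
  classical
  push Not at hn
  obtain ⟨hm, hm0⟩ := Nat.find_spec hn
  have hmin : ∀ n < Nat.find hn, 0 < shoot d c l r (n + 1) := fun n h => by
    have := Nat.find_min hn h
    push Not at this
    exact this (h.le.trans hm)
  set m := Nat.find hn
  have hm1 : 1 ≤ m := by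
    by_contra h0
    have : m = 0 := by omega
    rw [this] at hm0
    simp [shoot] at hm0
    linarith
  set ψ : ℤ → ℝ := (Icc (l + 1) (l + m)).indicator fun i => shoot d c l r (i - l).toNat
  have hin : ∀ n < m, ψ (l + n + 1) = shoot d c l r (n + 1) := fun n h => by
    have e : (l + (n : ℤ) + 1 - l).toNat = n + 1 := by omega
    rw [← e]
    exact indicator_of_mem ((mem_box _).2 ⟨n, h, rfl⟩) _
  have hout : ∀ i ∉ Icc (l + 1) (l + m), ψ i = 0 := fun i hi => indicator_of_notMem hi _
  have hin' : ∀ n ≤ m, ψ (l + n) = shoot d c l r n := by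
    intro n hn
    rcases n with _ | n
    · simpa [shoot] using hout l (by simp)
    · have := hin n (by omega)
      push_cast
      rwa [← add_assoc]
  have hle : r ≤ dirichletEigenvalue d c l m := by
    refine le_dirichletEigenvalue (ψ := ψ) hd (indicator_nonneg fun i hi => ?_) hout
      ⟨l + 1, ?_⟩ ?_
    · obtain ⟨n, h, rfl⟩ := (mem_box i).1 hi
      have e : (l + (n : ℤ) + 1 - l).toNat = n + 1 := by omega
      rw [e]
      exact (hmin n h).le
    · have := hin 0 hm1
      simp only [Nat.cast_zero, add_zero] at this
      rw [this]
      exact hmin 0 hm1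
    · intro i hi
      obtain ⟨n, h, rfl⟩ := (mem_box i).1 hi
      rw [linOp_shoot (r := r) hd n (hin' n h.le) (hin n h)]
      -- Equality except at the last site, where truncation replaces a nonpositive value by zero.
      have : shoot d c l r (n + 2) ≤ ψ (l + n + 2) := by
        rcases Nat.lt_or_ge (n + 1) m with h' | h'
        · have := hin (n + 1) h'
          push_cast at this
          rw [show l + (n : ℤ) + 2 = l + (n + 1) + 1 by ring, this]
        · rw [hout _ (by simp; omega)]
          rwa [show m = n + 1 by omega] at hm0
      have := mul_nonneg (hd (l + n + 2)).le (sub_nonneg.2 this)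
      linarith
  have := dirichletEigenvalue_mono (c := c) hd hm1 (le_refl l)
    (show l + (m : ℤ) ≤ l + k by omega)
  linarith

theorem dirichletEigenvalue_le (hd : ∀ i, 0 < d i) {M : ℝ} (hc : ∀ i, c i ≤ M) (hk : 1 ≤ k) :
    dirichletEigenvalue d c l k ≤ M :=
  (dirichletEigenvalue_lt_of_shoot_pos hd hk fun n hn =>
    (shoot_pos_of_large hd (fun _ _ => hc _) n hn).1).le

theorem dirichletEigenvalue_shift (d c : ℤ → ℝ) (l j : ℤ) (k : ℕ) :
    dirichletEigenvalue d c (l + j) k =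
      dirichletEigenvalue (fun i => d (i + j)) (fun i => c (i + j)) l k := by
  have hop : ∀ (φ : ℤ → ℝ) i, linOp (fun i => d (i + j)) (fun i => c (i + j))
      φ i = linOp d c (fun i => φ (i - j)) (i + j) := fun φ i => by
    simp only [linOp, diffusion, add_sub_cancel_right]
    rw [show i + 1 + j = i + j + 1 by ring, show i + j + 1 - j = i + 1 by ring,
      show i + j - 1 - j = i - 1 by ring]
  unfold dirichletEigenvalue
  congr 1
  ext r
  constructor
  · rintro ⟨φ, h1, h2, h3⟩
    refine ⟨fun i => φ (i + j), fun i hi => ?_, h2, ?_⟩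
    · rw [hop]
      simpa using h1 (i + j) ⟨by linarith [hi.1], by linarith [hi.2]⟩
    · rwa [show l + j + k + 1 = l + k + 1 + j by ring] at h3
  · rintro ⟨φ, h1, h2, h3⟩
    refine ⟨fun i => φ (i - j), fun i hi => ?_, by simpa using h2, ?_⟩
    · have := h1 (i - j) ⟨by linarith [hi.1], by linarith [hi.2]⟩
      rw [hop] at this
      simpa using this
    · rwa [show l + k + 1 = l + j + k + 1 - j by ring] at h3

end Dirichlet

/-! ### Recurrence with sublinear gaps -/

theorem iterate_vadd_one {Ω : Type*} [AddAction ℤ Ω] (n : ℕ) (ω : Ω) : ((1 : ℤ) +ᵥ ·)^[n] ω = (n : ℤ) +ᵥ ω := by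
  simp [vadd_iterate]

theorem iterate_vadd_neg_one {Ω : Type*} [AddAction ℤ Ω] (n : ℕ) (ω : Ω) : ((-1 : ℤ) +ᵥ ·)^[n] ω = (-n : ℤ) +ᵥ ω := by
  simp [vadd_iterate]

section Recurrence

variable {Ω : Type*} [MeasurableSpace Ω] {μ : Measure Ω} {S : Ω → Ω} {G : Set Ω}

/-- The points of `G` that stay out of `G` for the next `m` iterations of `S`. -/
def longReturn (S : Ω → Ω) (G : Set Ω) (m : ℕ) : Set Ω :=
  {ω | ω ∈ G ∧ ∀ i ∈ Icc 1 m, S^[i] ω ∉ G}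

theorem nullMeasurableSet_longReturn (hS : MeasurePreserving S μ μ)
    (hG : NullMeasurableSet G μ) (m : ℕ) : NullMeasurableSet (longReturn S G m) μ := by
  have : longReturn S G m = G ∩ ⋂ i ∈ Icc 1 m, (S^[i] ⁻¹' G)ᶜ := by
    ext ω
    simp [longReturn]
  rw [this]
  exact hG.inter <| .biInter (to_countable _) fun i _ =>
    (hG.preimage (hS.iterate i).quasiMeasurePreserving).compl

/-- A form of Kac's lemma. -/
theorem tsum_measure_longReturn_le [IsProbabilityMeasure μ] (hS : MeasurePreserving S μ μ)
    (hG : NullMeasurableSet G μ) : ∑' m, μ (longReturn S G m) ≤ 1 := by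
  refine ENNReal.tsum_le_of_sum_range_le fun N => ?_
  have hpre : ∀ m ∈ Finset.range N,
      μ (longReturn S G m) = μ (S^[N - m] ⁻¹' longReturn S G m) := fun m _ =>
    ((hS.iterate _).measure_preimage (nullMeasurableSet_longReturn hS hG m)).symm
  -- The `m`-th pulled-back event says that the last visit to `G` up to time `N` is at time `N - m`.
  have hdisj : ∀ m n, m < n → n < N →
      Disjoint (S^[N - m] ⁻¹' longReturn S G m) (S^[N - n] ⁻¹' longReturn S G n) := by
    intro m n hmn hn
    refine Set.disjoint_left.2 fun ω hm hn' => hn'.2 (n - m) ⟨by omega, by omega⟩ ?_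
    rw [← Function.iterate_add_apply, show n - m + (N - n) = N - m by omega]
    exact hm.1
  rw [Finset.sum_congr rfl hpre, ← measure_biUnion_finset₀]
  · exact prob_le_one
  · intro m hm n hn hmn
    refine Disjoint.aedisjoint ?_
    rw [Finset.coe_range, mem_Iio] at hm hn
    rcases lt_or_gt_of_ne hmn with h | h
    · exact hdisj m n h hn
    · exact (hdisj n m h hm).symm
  · exact fun m _ => (nullMeasurableSet_longReturn hS hG m).preimage
      (hS.iterate _).quasiMeasurePreserving

/-- Borel–Cantelli: each value of `j / q` is taken by exactly `q` indices `j`, so the series is `q`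
times the one in Kac's lemma. -/
theorem ae_eventually_not_longReturn [IsProbabilityMeasure μ] (hS : MeasurePreserving S μ μ)
    (hG : NullMeasurableSet G μ) {q : ℕ} (hq : 0 < q) :
    ∀ᵐ ω ∂μ, ∀ᶠ j in atTop, S^[j] ω ∉ longReturn S G (j / q) := by
  have : NeZero q := ⟨hq.ne'⟩
  refine ae_eventually_notMem (s := fun j => S^[j] ⁻¹' longReturn S G (j / q)) ?_
  have h1 : ∀ j, μ (S^[j] ⁻¹' longReturn S G (j / q)) = μ (longReturn S G (j / q)) := fun j =>
    (hS.iterate _).measure_preimage (nullMeasurableSet_longReturn hS hG _)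
  simp_rw [h1]
  rw [← (Nat.divModEquiv q).symm.tsum_eq,
    ENNReal.tsum_prod (f := fun m a => μ (longReturn S G ((Nat.divModEquiv q).symm (m, a) / q)))]
  have h2 : ∀ m (a : Fin q), (Nat.divModEquiv q).symm (m, a) / q = m := fun m a =>
    congrArg Prod.fst ((Nat.divModEquiv q).apply_symm_apply (m, a))
  simp_rw [h2]
  simp only [tsum_fintype, Finset.sum_const, Finset.card_univ, Fintype.card_fin, nsmul_eq_mul]
  rw [ENNReal.tsum_mul_left]
  exact ENNReal.mul_ne_top (ENNReal.natCast_ne_top q)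
    (ne_top_of_le_ne_top ENNReal.one_ne_top (tsum_measure_longReturn_le hS hG))

/-- The event of infinitely many visits is invariant, hence null or of full measure; Poincaré
recurrence puts almost all of `G` inside it. -/
theorem ae_frequently_iterate_mem [IsProbabilityMeasure μ] (hS : Ergodic S μ)
    (hG : NullMeasurableSet G μ) (h0 : μ G ≠ 0) : ∀ᵐ ω ∂μ, ∃ᶠ n in atTop, S^[n] ω ∈ G := by
  set E : Set Ω := {ω | ∃ᶠ n in atTop, S^[n] ω ∈ G} with hE
  have hEm : NullMeasurableSet E μ := by
    have : E = ⋂ N : ℕ, ⋃ n ∈ Ici N, S^[n] ⁻¹' G := by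
      ext ω
      simp [hE, frequently_atTop]
    rw [this]
    exact .iInter fun N => .biUnion (to_countable _) fun n _ =>
      hG.preimage (hS.toMeasurePreserving.iterate n).quasiMeasurePreserving
  have hinv : S ⁻¹' E = E := by
    ext ω
    have : (fun n => S^[n] (S ω) ∈ G) = fun n => S^[n + 1] ω ∈ G := by
      ext n
      rw [Function.iterate_succ_apply]
    change (∃ᶠ n in atTop, S^[n] (S ω) ∈ G) ↔ ∃ᶠ n in atTop, S^[n] ω ∈ G
    rw [this]
    conv_rhs => rw [← map_add_atTop_eq_nat 1, frequently_map]
  have hGE : ∀ᵐ ω ∂μ, ω ∈ G → ω ∈ E :=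
    hS.toMeasurePreserving.conservative.ae_mem_imp_frequently_image_mem hG
  rcases hS.quasiErgodic.ae_mem_or_ae_notMem₀ hEm (EventuallyEq.of_eq hinv) with h | h
  · exact h
  · refine absurd ?_ h0
    rw [measure_eq_zero_iff_ae_notMem]
    filter_upwards [hGE, h] with ω h1 h2 h3 using h2 (h1 h3)

/-- The gaps between successive visits of an orbit to a set of positive measure grow sublinearly. -/
theorem ae_exists_visit [IsProbabilityMeasure μ] (hS : Ergodic S μ)
    (hG : NullMeasurableSet G μ) (h0 : μ G ≠ 0) {q : ℕ} (hq : 0 < q) :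
    ∀ᵐ ω ∂μ, ∀ᶠ n : ℕ in atTop, ∃ m, n ≤ m ∧ m ≤ n + n / q ∧ S^[m] ω ∈ G := by
  filter_upwards [ae_frequently_iterate_mem hS hG h0,
    ae_eventually_not_longReturn hS.toMeasurePreserving hG hq] with ω h1 h2
  obtain ⟨N, hN⟩ := eventually_atTop.1 h2
  obtain ⟨j, hj, hjG⟩ := frequently_atTop.1 h1 N
  refine eventually_atTop.2 ⟨j, fun n hn => ?_⟩
  classical
  -- From the last visit `a ≤ n`, the orbit returns within `a / q ≤ n / q` steps, and by maximality
  -- of `a` only after time `n`.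
  have hlast : S^[Nat.findGreatest (fun i => S^[i] ω ∈ G) n] ω ∈ G :=
    Nat.findGreatest_spec (P := fun i => S^[i] ω ∈ G) hn hjG
  have hge := Nat.le_findGreatest (P := fun i => S^[i] ω ∈ G) hn hjG
  have hle := Nat.findGreatest_le (P := fun i => S^[i] ω ∈ G) n
  have hmax := fun i => Nat.findGreatest_is_greatest (P := fun i => S^[i] ω ∈ G) (n := n) (k := i)
  set a := Nat.findGreatest (fun i => S^[i] ω ∈ G) n
  have hnot := hN a (hj.trans hge)
  simp only [longReturn, mem_ofPred_eq, hlast, true_and] at hnot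
  push Not at hnot
  obtain ⟨i, ⟨hi1, hi2⟩, hi⟩ := hnot
  rw [← Function.iterate_add_apply] at hi
  have := Nat.div_le_div_right (c := q) hle
  refine ⟨i + a, ?_, by omega, hi⟩
  by_contra! hlt
  exact hmax (i + a) (by omega) hlt.le hi

variable [AddAction ℤ Ω] [MeasurableConstVAdd ℤ Ω] [ErgodicVAdd ℤ Ω μ]

/-- The hypothesis says that `g` generates `ℤ`, so a set invariant under `g` is invariant under the
whole action. -/
theorem ergodic_vadd {g : ℤ} (hg : ∀ n : ℤ, ∃ m : ℤ, n = m * g) : Ergodic ((g +ᵥ ·) : Ω → Ω) μ where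
  toMeasurePreserving := measurePreserving_vadd g μ
  aeconst_set := by
    intro s hs hinv
    refine aeconst_of_forall_preimage_vadd_ae_eq ℤ hs.nullMeasurableSet fun n => ?_
    suffices h : ((n +ᵥ ·) : Ω → Ω) ⁻¹' s = s from EventuallyEq.of_eq h
    have hmem : ∀ ω, g +ᵥ ω ∈ s ↔ ω ∈ s := fun ω => by
      conv_rhs => rw [← hinv]
      rfl
    obtain ⟨m, rfl⟩ := hg n
    ext ω
    change (m * g) +ᵥ ω ∈ s ↔ ω ∈ s
    induction m with
    | zero => simp
    | succ i ih => rw [add_mul, one_mul, add_comm, add_vadd, hmem, ih]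
    | pred i ih => rw [← hmem, ← add_vadd, ← ih]; ring_nf

theorem ergodic_vadd_one : Ergodic (((1 : ℤ) +ᵥ ·) : Ω → Ω) μ :=
  ergodic_vadd fun n => ⟨n, by simp⟩

theorem ergodic_vadd_neg_one : Ergodic (((-1 : ℤ) +ᵥ ·) : Ω → Ω) μ :=
  ergodic_vadd fun n => ⟨-n, by simp⟩

/-- Almost surely every site is within sublinear distance of the visits to a set of positive
measure. -/
theorem ae_sublinear_dist [IsProbabilityMeasure μ] (hG : NullMeasurableSet G μ) (h0 : μ G ≠ 0) :
    ∀ᵐ ω ∂μ, ∀ η > (0 : ℝ), ∀ᶠ i : ℤ in cofinite,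
      ∃ x : ℤ, x +ᵥ ω ∈ G ∧ |(i : ℝ) - x| ≤ η * |(i : ℝ)| := by
  have h1 : ∀ᵐ ω ∂μ, ∀ q : ℕ, ∀ᶠ n : ℕ in atTop, ∃ m, n ≤ m ∧ m ≤ n + n / (q + 1) ∧
      ((1 : ℤ) +ᵥ ·)^[m] ω ∈ G :=
    ae_all_iff.2 fun q => ae_exists_visit ergodic_vadd_one hG h0 q.succ_pos
  have h2 : ∀ᵐ ω ∂μ, ∀ q : ℕ, ∀ᶠ n : ℕ in atTop, ∃ m, n ≤ m ∧ m ≤ n + n / (q + 1) ∧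
      ((-1 : ℤ) +ᵥ ·)^[m] ω ∈ G :=
    ae_all_iff.2 fun q => ae_exists_visit ergodic_vadd_neg_one hG h0 q.succ_pos
  filter_upwards [h1, h2] with ω h1 h2 η hη
  obtain ⟨q, hq⟩ := exists_nat_one_div_lt hη
  have hdist : ∀ n m : ℕ, n ≤ m → m ≤ n + n / (q + 1) → (m : ℝ) - n ≤ η * n := by
    intro n m _ hm
    have : (m : ℝ) ≤ n + (n / (q + 1) : ℕ) := by exact_mod_cast hm
    have h3 : ((n / (q + 1) : ℕ) : ℝ) ≤ n / ((q + 1 : ℕ) : ℝ) := Nat.cast_div_le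
    have h4 : (n : ℝ) / ((q + 1 : ℕ) : ℝ) = 1 / (q + 1) * n := by push_cast; ring
    have := mul_le_mul_of_nonneg_right hq.le (Nat.cast_nonneg (α := ℝ) n)
    linarith
  obtain ⟨N1, hN1⟩ := eventually_atTop.1 (h1 q)
  obtain ⟨N2, hN2⟩ := eventually_atTop.1 (h2 q)
  rw [Int.cofinite_eq, eventually_sup]
  constructor
  · refine eventually_atBot.2 ⟨-(N2 : ℤ), fun i hi => ?_⟩
    obtain ⟨n, rfl⟩ : ∃ n : ℕ, i = -n := ⟨(-i).toNat, by omega⟩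
    obtain ⟨m, hm1, hm2, hm3⟩ := hN2 n (by omega)
    rw [iterate_vadd_neg_one] at hm3
    refine ⟨_, hm3, ?_⟩
    have hc : (n : ℝ) ≤ m := by exact_mod_cast hm1
    push_cast
    rw [abs_neg, Nat.abs_cast, show -(n : ℝ) - -m = m - n by ring, abs_of_nonneg (by linarith)]
    exact hdist n m hm1 hm2
  · refine eventually_atTop.2 ⟨(N1 : ℤ), fun i hi => ?_⟩
    obtain ⟨n, rfl⟩ : ∃ n : ℕ, i = n := ⟨i.toNat, by omega⟩
    obtain ⟨m, hm1, hm2, hm3⟩ := hN1 n (by omega)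
    rw [iterate_vadd_one] at hm3
    refine ⟨_, hm3, ?_⟩
    have hc : (n : ℝ) ≤ m := by exact_mod_cast hm1
    push_cast
    rw [Nat.abs_cast, abs_sub_comm, abs_of_nonneg (by linarith)]
    exact hdist n m hm1 hm2

end Recurrence

/-! ### Construction of admissible test functions -/

section Admissible

variable {d c : ℤ → ℝ}

theorem linOp_add_smul (d c φ ψ : ℤ → ℝ) (a : ℝ) (i : ℤ) :
    linOp d c (fun j => φ j + a * ψ j) i = linOp d c φ i + a * linOp d c ψ i := by
  simp only [linOp, diffusion]
  ring

theorem twistedOp_exp (d c Ψ : ℤ → ℝ) (p : ℝ) (i : ℤ) :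
    twistedOp d c p (fun j => Real.exp (-p * j) * Ψ j) i = Real.exp (-p * i) * linOp d c Ψ i := by
  have : (fun j : ℤ => Real.exp (p * j) * (Real.exp (-p * j) * Ψ j)) = Ψ := by
    ext j
    rw [← mul_assoc, ← Real.exp_add]
    simp
  rw [twistedOp, this]

theorem summable_exp_neg_abs : Summable fun n : ℤ => Real.exp (-|(n : ℝ)|) := by
  have h : Summable fun n : ℕ => Real.exp (-(n : ℝ)) := Real.summable_exp_neg_nat
  refine Summable.of_nat_of_neg ?_ ?_ <;> simpa using h

theorem exp_neg_abs_shift {K : ℝ} (hK : 0 ≤ K) {i j : ℤ} (hij : |(i : ℝ) - j| ≤ 1) (y : ℤ) :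
    Real.exp (-(K * |(j : ℝ) - y|)) ≤ Real.exp K * Real.exp (-(K * |(i : ℝ) - y|)) := by
  rw [← Real.exp_add, Real.exp_le_exp]
  have h1 : |(i : ℝ) - y| ≤ |(i : ℝ) - j| + |(j : ℝ) - y| := abs_sub_le _ _ _
  nlinarith

/-- Away from `y`, the neighbour of `i` nearer to `y` carries `exp K` times the value at `i`, which
outweighs every other term. At `y` there is no such neighbour, hence the defect. -/
theorem linOp_exp_neg_abs {δ D M K r : ℝ} (hδ : ∀ i, δ ≤ d i) (hδ0 : 0 < δ) (hD : ∀ i, d i ≤ D)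
    (hM : ∀ i, |c i| ≤ M) (hK : 2 * D + M + |r| ≤ δ * Real.exp K) (y i : ℤ) :
    r * Real.exp (-(K * |(i : ℝ) - y|)) - (if i = y then 2 * D + M + |r| else 0) ≤
      linOp d c (fun j : ℤ => Real.exp (-(K * |(j : ℝ) - y|))) i := by
  set T : ℤ → ℝ := fun j => Real.exp (-(K * |(j : ℝ) - y|)) with hT
  have hT0 : ∀ j, 0 < T j := fun j => Real.exp_pos _
  have hd0 : ∀ j, 0 < d j := fun j => hδ0.trans_le (hδ j)
  have hc := neg_le_of_abs_le (hM i)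
  have hr := le_abs_self r
  have hdi := hD i
  have hdi' := hD (i + 1)
  change r * T i - _ ≤ _
  have hlow : d (i + 1) * T (i + 1) + d i * T (i - 1) - (2 * D + M) * T i ≤ linOp d c T i := by
    simp only [linOp, diffusion]
    nlinarith [mul_nonneg (sub_nonneg.2 hdi) (hT0 i).le, mul_nonneg (sub_nonneg.2 hdi') (hT0 i).le,
      mul_le_mul_of_nonneg_right hc (hT0 i).le]
  have hp1 := mul_pos (hd0 (i + 1)) (hT0 (i + 1))
  have hp2 := mul_pos (hd0 i) (hT0 (i - 1))
  have hrT := mul_le_mul_of_nonneg_right hr (hT0 i).le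
  have hKT := mul_le_mul_of_nonneg_right hK (hT0 i).le
  rcases lt_trichotomy i y with h | rfl | h
  · rw [if_neg h.ne]
    have hi : (i : ℝ) + 1 ≤ y := by exact_mod_cast h
    have e : T (i + 1) = Real.exp K * T i := by
      simp only [hT]
      rw [← Real.exp_add]
      push_cast
      rw [abs_of_nonpos (by linarith), abs_of_nonpos (by linarith)]
      congr 1
      ring
    have := mul_le_mul_of_nonneg_right (hδ (i + 1)) (hT0 (i + 1)).le
    rw [e] at this hlow hp1
    linarith
  · rw [if_pos rfl]
    have e : T i = 1 := by simp [hT]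
    rw [e] at hlow ⊢
    linarith
  · rw [if_neg h.ne']
    have hi : (y : ℝ) + 1 ≤ i := by exact_mod_cast h
    have e : T (i - 1) = Real.exp K * T i := by
      simp only [hT]
      rw [← Real.exp_add]
      push_cast
      rw [abs_of_nonneg (by linarith), abs_of_nonneg (by linarith)]
      congr 1
      ring
    have := mul_le_mul_of_nonneg_right (hδ i) (hT0 (i - 1)).le
    rw [e] at this hlow hp2
    linarith

/-- A subsolution supported in a box yields a positive subsolution on the whole lattice, with
exponentially decaying tails. -/
theorem exists_tail_subsolution {δ D M K r s : ℝ} (hδ : ∀ i, δ ≤ d i) (hδ0 : 0 < δ)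
    (hD : ∀ i, d i ≤ D) (hM : ∀ i, |c i| ≤ M) (hK0 : 0 ≤ K)
    (hK : 2 * D + M + |r| ≤ δ * Real.exp K) (hrs : r < s) (k : ℕ) :
    ∃ ε > 0, ∃ C > 0, ∀ y : ℤ, (∃ ψ : ℤ → ℝ, (∀ i, 0 ≤ ψ i) ∧ (∀ i, ψ i ≤ 1) ∧ ψ y = 1 ∧
        (∀ i : ℤ, (k : ℝ) < |(i : ℝ) - y| → ψ i = 0) ∧ ∀ i, s * ψ i ≤ linOp d c ψ i) →
      ∃ g : ℤ → ℝ, (∀ i : ℤ, ε * Real.exp (-(K * |(i : ℝ) - y|)) ≤ g i) ∧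
        (∀ i : ℤ, g i ≤ C * Real.exp (-(K * |(i : ℝ) - y|))) ∧ ∀ i, r * g i ≤ linOp d c g i := by
  have hM0 : 0 ≤ M := (abs_nonneg _).trans (hM 0)
  have hD0 : 0 < D := hδ0.trans_le ((hδ 0).trans (hD 0))
  have hB : 0 < 2 * D + M + |r| := by positivity
  set B := 2 * D + M + |r| with hBdef
  -- With this `ε` the tail's defect `ε * B` at `y` equals the gain `(s - r) * ψ y`. Both constants
  -- are independent of `y`, which the superposition requires.
  refine ⟨(s - r) / B, div_pos (sub_pos.2 hrs) hB, Real.exp (K * k) + (s - r) / B,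
    add_pos (Real.exp_pos _) (div_pos (sub_pos.2 hrs) hB), ?_⟩
  have hε : 0 < (s - r) / B := div_pos (sub_pos.2 hrs) hB
  have hεB : (s - r) / B * B = s - r := div_mul_cancel₀ _ hB.ne'
  set ε := (s - r) / B
  rintro y ⟨ψ, h0, h1, hy, hout, hsub⟩
  refine ⟨fun i => ψ i + ε * Real.exp (-(K * |(i : ℝ) - y|)), fun i => by linarith [h0 i],
    fun i => ?_, fun i => ?_⟩
  · simp only [add_mul, ← Real.exp_add]
    by_cases h : (k : ℝ) < |(i : ℝ) - y|
    · rw [hout i h]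
      linarith [Real.exp_pos (K * k + -(K * |(i : ℝ) - y|))]
    · push Not at h
      have : (1 : ℝ) ≤ Real.exp (K * k + -(K * |(i : ℝ) - y|)) := by
        rw [Real.one_le_exp_iff]
        nlinarith
      linarith [h1 i]
  · rw [linOp_add_smul]
    have ht := mul_le_mul_of_nonneg_left
      (linOp_exp_neg_abs (r := r) hδ hδ0 hD hM hK y i) hε.le
    rw [mul_sub] at ht
    have hs := hsub i
    have hr := mul_le_mul_of_nonneg_right hrs.le (h0 i)
    rw [mul_add]
    split_ifs at ht with h
    · subst h
      rw [hεB] at ht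
      rw [hy] at hs hr ⊢
      linarith
    · rw [mul_zero] at ht
      linarith

theorem tendsto_log_div_of_bounds {φ : ℤ → ℝ} {Y : Set ℤ} {ε C Q : ℝ} (hε : 0 < ε)
    (hQ : 0 ≤ Q) (hup : ∀ i, φ i ≤ C) (hlow : ∀ y ∈ Y, ∀ i : ℤ,
      ε * Real.exp (-(Q * |(i : ℝ) - y|)) ≤ φ i)
    (hdens : ∀ η > (0 : ℝ), ∀ᶠ i : ℤ in cofinite, ∃ y ∈ Y, |(i : ℝ) - y| ≤ η * |(i : ℝ)|) :
    Tendsto (fun i : ℤ => Real.log (φ i) / (i : ℝ)) cofinite (𝓝 0) := by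
  rw [Metric.tendsto_nhds]
  intro e he
  -- Half of `e` absorbs the distance term, the other half the constants once `|i| > N`; `Q + 1`
  -- covers `Q = 0`.
  have hη : 0 < e / (2 * (Q + 1)) := by positivity
  obtain ⟨N, hN⟩ := exists_nat_gt (2 * (|Real.log C| + |Real.log ε|) / e)
  filter_upwards [hdens _ hη, (Set.finite_Icc (-(N : ℤ)) N).eventually_cofinite_notMem]
    with i ⟨y, hyY, hy⟩ hi
  have hiN : (N : ℝ) < |(i : ℝ)| := by
    have : (N : ℤ) < |i| := by
      rw [mem_Icc, ← abs_le] at hi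
      exact not_le.1 hi
    exact_mod_cast this
  have hi0 : 0 < |(i : ℝ)| := (Nat.cast_nonneg N).trans_lt hiN
  have hA : 2 * (|Real.log C| + |Real.log ε|) < e * |(i : ℝ)| := by
    rw [div_lt_iff₀ he] at hN
    nlinarith
  have hφ : 0 < φ i := (mul_pos hε (Real.exp_pos _)).trans_le (hlow y hyY i)
  have hu : Real.log (φ i) ≤ Real.log C := Real.log_le_log hφ (hup i)
  have hl : Real.log ε - Q * |(i : ℝ) - y| ≤ Real.log (φ i) := by
    have := Real.log_le_log (mul_pos hε (Real.exp_pos _)) (hlow y hyY i)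
    rw [Real.log_mul hε.ne' (Real.exp_pos _).ne', Real.log_exp] at this
    linarith
  have hQy : Q * |(i : ℝ) - y| ≤ e / 2 * |(i : ℝ)| := by
    have h1 : Q * |(i : ℝ) - y| ≤ (Q + 1) * (e / (2 * (Q + 1)) * |(i : ℝ)|) := by
      have := abs_nonneg ((i : ℝ) - y)
      exact mul_le_mul (by linarith) hy this (by linarith)
    have h2 : (Q + 1) * (e / (2 * (Q + 1)) * |(i : ℝ)|) = e / 2 * |(i : ℝ)| := by
      field_simp
    linarith
  rw [dist_zero_right, Real.norm_eq_abs, abs_div, div_lt_iff₀ hi0, abs_lt]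
  have h1 := le_abs_self (Real.log C)
  have h2 := neg_abs_le (Real.log ε)
  have h3 := abs_nonneg (Real.log C)
  have h4 := abs_nonneg (Real.log ε)
  constructor <;> linarith

theorem memℓp_ratio {φ : ℤ → ℝ} {R : ℝ} (hφ : ∀ i, 0 < φ i) {σ : ℤ → ℤ}
    (hσ : ∀ i, φ (σ i) ≤ R * φ i) : Memℓp (fun i : ℤ => (φ (σ i) - φ i) / φ i) ⊤ := by
  refine memℓp_infty ⟨R + 1, ?_⟩
  rintro _ ⟨i, rfl⟩
  have := hσ i
  have h1 := hφ i
  have h2 := hφ (σ i)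
  simp only [Real.norm_eq_abs]
  rw [abs_div, abs_of_pos h1, div_le_iff₀ h1, abs_le]
  constructor <;> nlinarith

/-- Superposing tailed subsolutions centred at a set that meets every sublinear neighbourhood gives
an admissible test function for every twist `p`. -/
theorem exists_admissible {δ D M r s : ℝ} (hδ : ∀ i, δ ≤ d i) (hδ0 : 0 < δ)
    (hD : ∀ i, d i ≤ D) (hM : ∀ i, |c i| ≤ M) (hrs : r < s) (k : ℕ) {Y : Set ℤ}
    (hY : ∀ y ∈ Y, ∃ ψ : ℤ → ℝ, (∀ i, 0 ≤ ψ i) ∧ (∀ i, ψ i ≤ 1) ∧ ψ y = 1 ∧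
      (∀ i : ℤ, (k : ℝ) < |(i : ℝ) - y| → ψ i = 0) ∧ ∀ i, s * ψ i ≤ linOp d c ψ i)
    (hdens : ∀ η > (0 : ℝ), ∀ᶠ i : ℤ in cofinite, ∃ y ∈ Y, |(i : ℝ) - y| ≤ η * |(i : ℝ)|)
    (p : ℝ) : ∃ φ ∈ admissible, ∀ i, r * φ i ≤ twistedOp d c p φ i := by
  have hM0 : 0 ≤ M := (abs_nonneg _).trans (hM 0)
  have hD0 : 0 < D := hδ0.trans_le ((hδ 0).trans (hD 0))
  -- `|p| + 1` leaves a summable factor `exp (-|i - y|)` after weighting; the quotient makes the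
  -- tail a subsolution, since `K ≤ exp K`.
  set K := |p| + 1 + (2 * D + M + |r|) / δ with hKdef
  have hKp : |p| + 1 ≤ K := by
    have : 0 ≤ (2 * D + M + |r|) / δ := by positivity
    linarith
  have hK0 : 0 ≤ K := by linarith [abs_nonneg p]
  have hK : 2 * D + M + |r| ≤ δ * Real.exp K := by
    have h1 : (2 * D + M + |r|) / δ ≤ Real.exp K := by
      linarith [Real.add_one_le_exp K, abs_nonneg p]
    exact ((div_le_iff₀ hδ0).1 h1).trans_eq (mul_comm _ _)
  obtain ⟨ε, hε, C, hC, hg⟩ := exists_tail_subsolution hδ hδ0 hD hM hK0 hK hrs k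
  choose g hglow hgup hgsub using fun y : Y => hg y (hY y y.2)
  have hg0 : ∀ y i, 0 < g y i := fun y i => (mul_pos hε (Real.exp_pos _)).trans_le (hglow y i)
  -- The weight gives the bump at `y` size of order `exp (p * i)` near `y`, exactly what the twist
  -- removes.
  set a : Y → ℤ → ℝ := fun y i => Real.exp (p * y) * g y i with ha
  have ha0 : ∀ y i, 0 < a y i := fun y i => mul_pos (Real.exp_pos _) (hg0 y i)
  have hsumE : ∀ i : ℤ, Summable fun y : ℤ => Real.exp (-|((i - y : ℤ) : ℝ)|) := fun i =>
    (Equiv.subLeft i).summable_iff.2 summable_exp_neg_abs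
  have haup : ∀ y i, a y i ≤ C * Real.exp (p * i) * Real.exp (-|((i - y : ℤ) : ℝ)|) := by
    intro y i
    have h1 := mul_le_mul_of_nonneg_left (hgup y i) (Real.exp_pos (p * y)).le
    refine h1.trans ?_
    rw [mul_left_comm, mul_assoc, ← Real.exp_add, ← Real.exp_add]
    refine mul_le_mul_of_nonneg_left (Real.exp_le_exp.2 ?_) hC.le
    push_cast
    have h2 : p * ((y : ℤ) - i) ≤ |p| * |(i : ℝ) - (y : ℤ)| := by
      rw [abs_sub_comm, ← abs_mul]
      exact le_abs_self _
    nlinarith [mul_le_mul_of_nonneg_right hKp (abs_nonneg ((i : ℝ) - (y : ℤ)))]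
  have hsum : ∀ i, Summable fun y => a y i := fun i =>
    Summable.of_nonneg_of_le (fun y => (ha0 y i).le) (fun y => haup y i)
      (((hsumE i).comp_injective Subtype.val_injective).mul_left _)
  set Z := ∑' n : ℤ, Real.exp (-|(n : ℝ)|)
  set Ψ : ℤ → ℝ := fun i => ∑' y, a y i with hΨ
  have hΨup : ∀ i : ℤ, Ψ i ≤ C * Real.exp (p * i) * Z := by
    intro i
    have h1 : ∑' y : ℤ, Real.exp (-|((i - y : ℤ) : ℝ)|) = Z :=
      (Equiv.subLeft i).tsum_eq fun n : ℤ => Real.exp (-|(n : ℝ)|)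
    rw [← h1, ← tsum_mul_left]
    exact Summable.tsum_le_tsum_of_inj Subtype.val Subtype.val_injective
      (fun _ _ => by positivity) (fun y => haup y i) (hsum i) ((hsumE i).mul_left _)
  have hΨlow : ∀ y ∈ Y, ∀ i : ℤ,
      ε * (Real.exp (p * i) * Real.exp (-((|p| + K) * |(i : ℝ) - y|))) ≤ Ψ i := by
    intro y hy i
    refine le_trans ?_ ((hsum i).le_tsum ⟨y, hy⟩ fun z _ => (ha0 z i).le)
    refine le_trans ?_ (mul_le_mul_of_nonneg_left (hglow ⟨y, hy⟩ i) (Real.exp_pos _).le)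
    rw [mul_left_comm (Real.exp _), ← Real.exp_add, ← Real.exp_add]
    refine mul_le_mul_of_nonneg_left (Real.exp_le_exp.2 ?_) hε.le
    have h2 : p * ((i : ℝ) - y) ≤ |p| * |(i : ℝ) - y| := by
      rw [← abs_mul]
      exact le_abs_self _
    simp only
    linarith
  -- Neighbouring values are comparable term by term, uniformly in the centre `y`.
  have hΨratio : ∀ i j : ℤ, |(i : ℝ) - j| ≤ 1 → Ψ j ≤ C * Real.exp K / ε * Ψ i := by
    intro i j hij
    simp only [hΨ]
    rw [← tsum_mul_left]
    refine (hsum j).tsum_le_tsum (fun y => ?_) ((hsum i).mul_left _)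
    simp only [ha]
    rw [mul_left_comm]
    refine mul_le_mul_of_nonneg_left ?_ (Real.exp_pos _).le
    calc g y j ≤ C * Real.exp (-(K * |(j : ℝ) - y|)) := hgup y j
      _ ≤ C * (Real.exp K * Real.exp (-(K * |(i : ℝ) - y|))) :=
        mul_le_mul_of_nonneg_left (exp_neg_abs_shift hK0 hij y) hC.le
      _ = C * Real.exp K / ε * (ε * Real.exp (-(K * |(i : ℝ) - y|))) := by field_simp
      _ ≤ C * Real.exp K / ε * g y i :=
        mul_le_mul_of_nonneg_left (hglow y i) (by positivity)
  have hΨsub : ∀ i, r * Ψ i ≤ linOp d c Ψ i := by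
    intro i
    have h : HasSum (fun y => linOp d c (a y) i) (linOp d c Ψ i) := by
      have h1 := (hsum (i + 1)).hasSum
      have h2 := (hsum i).hasSum
      have h3 := (hsum (i - 1)).hasSum
      exact (((h1.sub h2).mul_left _).add ((h3.sub h2).mul_left _)).add (h2.mul_left _)
    refine hasSum_le (fun y => ?_) ((hsum i).hasSum.mul_left r) h
    have h1 := linOp_add_smul d c (fun _ => 0) (g y) (Real.exp (p * (y : ℤ))) i
    have h2 : linOp d c (fun _ => 0) i = 0 := by simp [linOp, diffusion]
    simp only [zero_add, h2] at h1
    rw [show linOp d c (a y) i = _ from h1]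
    simp only [ha]
    rw [mul_left_comm]
    exact mul_le_mul_of_nonneg_left (hgsub y i) (Real.exp_pos _).le
  obtain ⟨y₀, hy₀⟩ : Y.Nonempty := by
    obtain ⟨i, y, hy, -⟩ := (hdens 1 one_pos).exists
    exact ⟨y, hy⟩
  have hee : ∀ i : ℤ, Real.exp (-p * i) * Real.exp (p * i) = 1 := fun i => by
    rw [← Real.exp_add]
    simp
  have hφlow : ∀ y ∈ Y, ∀ i : ℤ,
      ε * Real.exp (-((|p| + K) * |(i : ℝ) - y|)) ≤ Real.exp (-p * i) * Ψ i := by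
    intro y hy i
    have := mul_le_mul_of_nonneg_left (hΨlow y hy i) (Real.exp_pos (-p * i)).le
    linear_combination this - ε * Real.exp (-((|p| + K) * |(i : ℝ) - y|)) * hee i
  have hφup : ∀ i : ℤ, Real.exp (-p * i) * Ψ i ≤ C * Z := by
    intro i
    have := mul_le_mul_of_nonneg_left (hΨup i) (Real.exp_pos (-p * i)).le
    linear_combination this + C * Z * hee i
  have hφ0 : ∀ i : ℤ, 0 < Real.exp (-p * i) * Ψ i := fun i =>
    (mul_pos hε (Real.exp_pos _)).trans_le (hφlow y₀ hy₀ i)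
  have hφratio : ∀ i j : ℤ, |(i : ℝ) - j| ≤ 1 → Real.exp (-p * j) * Ψ j ≤
      Real.exp |p| * (C * Real.exp K / ε) * (Real.exp (-p * i) * Ψ i) := by
    intro i j hij
    have h1 : Real.exp (-p * j) ≤ Real.exp |p| * Real.exp (-p * i) := by
      rw [← Real.exp_add, Real.exp_le_exp]
      have : p * ((i : ℝ) - j) ≤ |p| * 1 := by
        refine (le_abs_self _).trans ?_
        rw [abs_mul]
        exact mul_le_mul_of_nonneg_left hij (abs_nonneg p)
      linarith
    have hj : 0 ≤ Ψ j := tsum_nonneg fun y => (ha0 y j).le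
    calc Real.exp (-p * j) * Ψ j
        ≤ (Real.exp |p| * Real.exp (-p * i)) * (C * Real.exp K / ε * Ψ i) :=
          mul_le_mul h1 (hΨratio i j hij) hj (by positivity)
      _ = _ := by ring
  refine ⟨fun i => Real.exp (-p * i) * Ψ i, ⟨hφ0, ?_, ?_, ?_⟩, fun i => ?_⟩
  · exact tendsto_log_div_of_bounds hε (by linarith [abs_nonneg p]) hφup hφlow hdens
  · exact memℓp_ratio hφ0 fun i => hφratio i (i + 1) (by simp)
  · exact memℓp_ratio hφ0 fun i => hφratio i (i - 1) (by simp)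
  · rw [twistedOp_exp, mul_left_comm]
    exact mul_le_mul_of_nonneg_left (hΨsub i) (Real.exp_pos _).le

end Admissible

/-! ### From Dirichlet boxes to the generalized eigenvalue -/

section Medium

variable {d c : ℤ → ℝ}

/-- Recentring at a maximum point `y` provides both `ψ ≤ 1` and `ψ y = 1`, at the cost of moving the
centre by at most `k`. -/
theorem exists_normalized_subsolution (hd : ∀ i, 0 < d i) {k : ℕ} (hk : 1 ≤ k) {x : ℤ} {s : ℝ}
    (hs : s ≤ dirichletEigenvalue d c x k) :
    ∃ y : ℤ, |(x : ℝ) - y| ≤ k ∧ ∃ ψ : ℤ → ℝ, (∀ i, 0 ≤ ψ i) ∧ (∀ i, ψ i ≤ 1) ∧ ψ y = 1 ∧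
      (∀ i : ℤ, (k : ℝ) < |(i : ℝ) - y| → ψ i = 0) ∧ ∀ i, s * ψ i ≤ linOp d c ψ i := by
  obtain ⟨ψ, h0, hpos, hout, hsub⟩ := exists_subsolution hd c x hk
  obtain ⟨y, hy, hmax⟩ := (Finset.Icc (x + 1) (x + k)).exists_max_image ψ
    ⟨x + 1, Finset.mem_Icc.2 ⟨le_rfl, by omega⟩⟩
  rw [Finset.mem_Icc] at hy
  have hψy : 0 < ψ y := hpos y hy
  have hdist : ∀ i ∈ Icc x (x + k), |(i : ℝ) - y| ≤ k := by
    intro i hi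
    have : |i - y| ≤ k := abs_le.2 ⟨by linarith [hi.1, hy.2], by linarith [hi.2, hy.1]⟩
    exact_mod_cast this
  refine ⟨y, hdist x ⟨le_rfl, by omega⟩, fun i => ψ i / ψ y, fun i => div_nonneg (h0 i) hψy.le,
    fun i => ?_, div_self hψy.ne', fun i hi => ?_, fun i => ?_⟩
  · rw [div_le_one hψy]
    by_cases h : i ∈ Icc (x + 1) (x + k)
    · exact hmax i (Finset.mem_Icc.2 h)
    · rw [hout i h]
      exact hψy.le
  · have : i ∉ Icc (x + 1) (x + k) := fun h =>
      not_le.2 hi (hdist i ⟨by linarith [h.1], h.2⟩)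
    simp [hout i this]
  · have h1 : linOp d c (fun i => ψ i / ψ y) i = linOp d c ψ i / ψ y := by
      simp only [linOp, diffusion]
      ring
    rw [h1, mul_div_assoc']
    exact div_le_div_of_nonneg_right
      ((mul_le_mul_of_nonneg_right hs (h0 i)).trans (hsub i)) hψy.le

theorem le_lowerEigenvalue {δ D M r s : ℝ} (hδ : ∀ i, δ ≤ d i) (hδ0 : 0 < δ)
    (hD : ∀ i, d i ≤ D) (hM : ∀ i, |c i| ≤ M) (hrs : r < s) {k : ℕ} (hk : 1 ≤ k)
    (hdens : ∀ η > (0 : ℝ), ∀ᶠ i : ℤ in cofinite,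
      ∃ x : ℤ, s ≤ dirichletEigenvalue d c x k ∧ |(i : ℝ) - x| ≤ η * |(i : ℝ)|) (p : ℝ) :
    (r : EReal) ≤ lowerEigenvalue d c p := by
  have hd : ∀ i, 0 < d i := fun i => hδ0.trans_le (hδ i)
  have hdensY : ∀ η > (0 : ℝ), ∀ᶠ i : ℤ in cofinite,
      ∃ y ∈ {y : ℤ | ∃ ψ : ℤ → ℝ, (∀ i, 0 ≤ ψ i) ∧ (∀ i, ψ i ≤ 1) ∧ ψ y = 1 ∧
        (∀ i : ℤ, (k : ℝ) < |(i : ℝ) - y| → ψ i = 0) ∧ ∀ i, s * ψ i ≤ linOp d c ψ i},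
      |(i : ℝ) - y| ≤ η * |(i : ℝ)| := by
    intro η hη
    -- Beyond `N`, the displacement `k` is at most `η / 2 * |i|`.
    obtain ⟨N, hN⟩ := exists_nat_gt (2 * k / η)
    filter_upwards [hdens (η / 2) (half_pos hη),
      (Set.finite_Icc (-(N : ℤ)) N).eventually_cofinite_notMem] with i ⟨x, hx, hix⟩ hi
    have hiN : (N : ℝ) < |(i : ℝ)| := by
      have : (N : ℤ) < |i| := by
        rw [mem_Icc, ← abs_le] at hi
        exact not_le.1 hi
      exact_mod_cast this
    obtain ⟨y, hxy, hy⟩ := exists_normalized_subsolution hd hk hx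
    refine ⟨y, hy, ?_⟩
    rw [div_lt_iff₀ hη] at hN
    have h1 := mul_lt_mul_of_pos_right hiN hη
    have h2 := abs_sub_le (i : ℝ) x y
    linarith
  obtain ⟨φ, hφ, hsub⟩ := exists_admissible hδ hδ0 hD hM hrs k (fun y hy => hy) hdensY p
  exact le_sSup ⟨r, ⟨φ, hφ, hsub⟩, rfl⟩

theorem IsKPPMedium.exists_bounds {γ : ℝ} {f : ℤ → ℝ → ℝ} (h : IsKPPMedium γ d f) :
    ∃ δ D M : ℝ, 0 < δ ∧ (∀ i, δ ≤ d i) ∧ (∀ i, d i ≤ D) ∧ ∀ i, |linRate f i| ≤ M := by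
  obtain ⟨D, hD⟩ := h.sup_d_lt
  obtain ⟨-, M, hM⟩ := h.smooth
  have hbdd : BddBelow (range d) := by
    by_contra hn
    have := h.inf_d_pos
    rw [iInf, Real.sInf_of_not_bddBelow hn] at this
    exact lt_irrefl _ this
  exact ⟨⨅ i, d i, D, M, h.inf_d_pos, fun i => ciInf_le hbdd i, fun i => hD ⟨i, rfl⟩,
    fun i => (hM i 0 (by simp)).2.1⟩

/-- Difference quotients along a sequence exhibit the derivative as an almost sure limit of
measurable functions. -/
theorem IsKPPMedium.tendsto_linRate {γ : ℝ} {f : ℤ → ℝ → ℝ} (h : IsKPPMedium γ d f) (i : ℤ) :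
    Tendsto (fun n : ℕ => ((n : ℝ) + 1) * f i (1 / ((n : ℝ) + 1))) atTop (𝓝 (linRate f i)) := by
  have h1 := (h.smooth.1 i 0 (by simp)).hasDerivWithinAt
  rw [hasDerivWithinAt_iff_tendsto_slope] at h1
  have h2 : Tendsto (fun n : ℕ => 1 / ((n : ℝ) + 1)) atTop (𝓝[Icc (0 : ℝ) 1 \ {0}] 0) := by
    refine tendsto_nhdsWithin_iff.2 ⟨tendsto_one_div_add_atTop_nhds_zero_nat,
      Eventually.of_forall fun n => ⟨⟨by positivity, ?_⟩, ?_⟩⟩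
    · rw [div_le_one (by positivity)]
      linarith [Nat.cast_nonneg (α := ℝ) n]
    · simp only [mem_singleton_iff]
      positivity
  refine (h1.comp h2).congr fun n => ?_
  simp [slope, h.zero_left i]

end Medium

/-! ### Measurability of rates and eigenvalues -/

section Measurability

variable {Ω : Type*} [MeasurableSpace Ω] {P : Measure Ω}

theorem aemeasurable_linRate {γ : ℝ} {d : ℤ → Ω → ℝ} {f : ℤ → ℝ → Ω → ℝ}
    (hf : ∀ i, ∀ s ∈ Icc (0 : ℝ) 1, Measurable (f i s))
    (hmedium : ∀ᵐ ω ∂P, IsKPPMedium γ (fun i => d i ω) (fun i s => f i s ω)) (i : ℤ) :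
    AEMeasurable (fun ω => linRate (fun j s => f j s ω) i) P := by
  refine aemeasurable_of_tendsto_metrizable_ae' (f := fun (n : ℕ) ω =>
    ((n : ℝ) + 1) * f i (1 / ((n : ℝ) + 1)) ω) (fun n => ?_) ?_
  · refine (Measurable.const_mul (hf i _ ⟨by positivity, ?_⟩) _).aemeasurable
    rw [div_le_one (by positivity)]
    linarith [Nat.cast_nonneg (α := ℝ) n]
  · filter_upwards [hmedium] with ω hω using hω.tendsto_linRate i

theorem nullMeasurableSet_le_dirichletEigenvalue {d c : ℤ → Ω → ℝ}
    (hd : ∀ i, Measurable (d i)) (hc : ∀ i, AEMeasurable (c i) P)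
    (hpos : ∀ᵐ ω ∂P, ∀ i, 0 < d i ω) (l : ℤ) {k : ℕ} (hk : 1 ≤ k) (r : ℝ) :
    NullMeasurableSet
      {ω | r ≤ dirichletEigenvalue (fun i => d i ω) (fun i => c i ω) l k} P := by
  have hm : MeasurableSet {ω | ∀ n ≤ k,
      0 < shoot (fun i => d i ω) (fun i => (hc i).mk _ ω) l r (n + 1)} := by
    simp only [ofPred_forall]
    exact .iInter fun n => .iInter fun _ => measurableSet_lt measurable_const
      (measurable_shoot hd (fun i => (hc i).measurable_mk) l r (n + 1))
  refine hm.compl.nullMeasurableSet.congr ?_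
  have hce : ∀ᵐ ω ∂P, ∀ i, c i ω = (hc i).mk _ ω := ae_all_iff.2 fun i => (hc i).ae_eq_mk
  filter_upwards [hce, hpos] with ω h1 h2
  refine propext ?_
  change ¬ (∀ n ≤ k, 0 < shoot (fun i => d i ω) (fun i => (hc i).mk _ ω) l r (n + 1)) ↔
    r ≤ dirichletEigenvalue (fun i => d i ω) (fun i => c i ω) l k
  simp only [← h1]
  rw [← dirichletEigenvalue_lt_iff h2 hk, not_lt]

end Measurability

/-! ### The constant `Γinf` and conclusion -/

/-- Countably many tolerances, so that the almost sure bounds can be intersected. -/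
theorem tendsto_of_forall_nat {u : ℕ → ℝ} {L : ℝ}
    (hlow : ∀ n : ℕ, ∀ᶠ k in atTop, L - 1 / ((n : ℝ) + 1) ≤ u k)
    (hup : ∀ n : ℕ, ∀ᶠ k in atTop, u k ≤ L + 1 / ((n : ℝ) + 1)) :
    Tendsto u atTop (𝓝 L) := by
  refine tendsto_order.2 ⟨fun a ha => ?_, fun a ha => ?_⟩
  · obtain ⟨n, hn⟩ := exists_nat_one_div_lt (sub_pos.2 ha)
    filter_upwards [hlow n] with k hk
    linarith
  · obtain ⟨n, hn⟩ := exists_nat_one_div_lt (sub_pos.2 ha)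
    filter_upwards [hup n] with k hk
    linarith

end KPPLattice

open KPPLattice in
theorem theorem6p3 {Ω : Type*} [MeasurableSpace Ω] (P : Measure Ω) [IsProbabilityMeasure P]
    [AddAction ℤ Ω] [MeasurableConstVAdd ℤ Ω] [ErgodicVAdd ℤ Ω P]
    (γ : ℝ) (hγ : 0 < γ) (hγ' : γ ≤ 1)
    (d : ℤ → Ω → ℝ) (f : ℤ → ℝ → Ω → ℝ)
    (hd_meas : ∀ i, Measurable (d i))
    (hf_meas : ∀ i, ∀ s ∈ Icc (0 : ℝ) 1, Measurable (f i s))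
    (c : ℤ → Ω → ℝ) (hc : ∀ i ω, c i ω = KPPLattice.linRate (fun j s => f j s ω) i)
    (hmedium : ∀ᵐ ω ∂P, KPPLattice.IsKPPMedium γ (fun i => d i ω) (fun i s => f i s ω))
    (hd_stat : ∀ᵐ ω ∂P, ∀ i j : ℤ, d (i + j) ω = d i (j +ᵥ ω))
    (hc_stat : ∀ᵐ ω ∂P, ∀ i j : ℤ, c (i + j) ω = c i (j +ᵥ ω))
    (Γ : ℤ → ℕ → Ω → ℝ)
    (hΓ : ∀ l k ω,
      Γ l k ω = KPPLattice.dirichletEigenvalue (fun i => d i ω) (fun i => c i ω) l k) :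
    ∃ Γinf : ℝ,
      (∀ᵐ ω ∂P,
        Tendsto (fun k : ℕ => Γ (-(k : ℤ)) (2 * k) ω) atTop (𝓝 Γinf) ∧
        Tendsto (fun k : ℕ => Γ (-(k : ℤ)) k ω) atTop (𝓝 Γinf) ∧
        Tendsto (fun k : ℕ => Γ 0 k ω) atTop (𝓝 Γinf)) ∧
      ∃ Ω'' : Set Ω, MeasurableSet Ω'' ∧ P Ω'' = 1 ∧
        ∀ ω ∈ Ω'', ∀ p : ℝ,
          (Γinf : EReal) ≤
            KPPLattice.lowerEigenvalue (fun i => d i ω) (fun i => c i ω) p := by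
  have hbounds : ∀ᵐ ω ∂P, ∃ δ D M : ℝ, 0 < δ ∧ (∀ i, δ ≤ d i ω) ∧ (∀ i, d i ω ≤ D) ∧
      ∀ i, |c i ω| ≤ M := by
    filter_upwards [hmedium] with ω hω
    simpa only [hc] using hω.exists_bounds
  have hpos : ∀ᵐ ω ∂P, ∀ i, 0 < d i ω := by
    filter_upwards [hbounds] with ω ⟨δ, _, _, hδ0, hδ, _⟩ i using hδ0.trans_le (hδ i)
  have hcm : ∀ i, AEMeasurable (c i) P := fun i => by
    rw [show c i = fun ω => linRate (fun j s => f j s ω) i from funext (hc i)]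
    exact aemeasurable_linRate hf_meas hmedium i
  have hnull : ∀ (k : ℕ), 1 ≤ k → ∀ r : ℝ, NullMeasurableSet {ω | r ≤ Γ 0 k ω} P := by
    intro k hk r
    simp only [hΓ]
    exact nullMeasurableSet_le_dirichletEigenvalue hd_meas hcm hpos 0 hk r
  have hshift : ∀ᵐ ω ∂P, ∀ (l : ℤ) (k : ℕ), Γ l k ω = Γ 0 k (l +ᵥ ω) := by
    filter_upwards [hd_stat, hc_stat] with ω h1 h2 l k
    rw [hΓ, hΓ, ← zero_add l, dirichletEigenvalue_shift]
    simp only [h1, h2, zero_add]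
  have hmono : ∀ᵐ ω ∂P, ∀ (l l' : ℤ) (k k' : ℕ), 1 ≤ k → l' ≤ l → l + k ≤ l' + k' →
      Γ l k ω ≤ Γ l' k' ω := by
    filter_upwards [hpos] with ω h l l' k k' hk hl hr
    rw [hΓ, hΓ]
    exact dirichletEigenvalue_mono h hk hl hr
  set Λ : Set ℝ := {r | ∃ k : ℕ, 1 ≤ k ∧ P {ω | r ≤ Γ 0 k ω} ≠ 0} with hΛ
  have hdown : ∀ r ∈ Λ, ∀ s ≤ r, s ∈ Λ := by
    rintro r ⟨k, hk, h⟩ s hs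
    exact ⟨k, hk, fun h0 => h (measure_mono_null (fun ω hω => hs.trans hω) h0)⟩
  have hlow : ∀ r ∈ Λ, ∀ᵐ ω ∂P, (∀ᶠ K : ℕ in atTop, r ≤ Γ 0 K ω) ∧
      ∀ᶠ K : ℕ in atTop, r ≤ Γ (-(K : ℤ)) K ω := by
    rintro r ⟨k, hk, h0⟩
    filter_upwards [hshift, hmono, ae_frequently_iterate_mem ergodic_vadd_one (hnull k hk r) h0,
      ae_frequently_iterate_mem ergodic_vadd_neg_one (hnull k hk r) h0] with ω h1 h2 h3 h4
    constructor
    · obtain ⟨m, hm⟩ := h3.exists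
      rw [iterate_vadd_one, ← h1] at hm
      filter_upwards [eventually_ge_atTop (m + k)] with K hK
      exact hm.trans (h2 _ _ _ _ hk (by omega) (by omega))
    -- `m ≥ k` keeps the box starting after `-m` inside the sites up to `0`.
    · obtain ⟨m, hkm, hm⟩ := frequently_atTop.1 h4 k
      rw [iterate_vadd_neg_one, ← h1] at hm
      filter_upwards [eventually_ge_atTop m] with K hK
      exact hm.trans (h2 _ _ _ _ hk (by omega) (by omega))
  have hup : ∀ r ∉ Λ, ∀ᵐ ω ∂P, ∀ (l : ℤ) (k : ℕ), 1 ≤ k → Γ l k ω ≤ r := by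
    intro r hr
    have h1 : ∀ᵐ ω ∂P, ∀ k : ℕ, 1 ≤ k → Γ 0 k ω ≤ r := by
      refine ae_all_iff.2 fun k => ?_
      by_cases hk : 1 ≤ k
      · have h0 : P {ω | r ≤ Γ 0 k ω} = 0 := by
          by_contra h
          exact hr ⟨k, hk, h⟩
        filter_upwards [measure_eq_zero_iff_ae_notMem.1 h0] with ω hω _
        exact (not_le.1 hω).le
      · exact Eventually.of_forall fun _ h => absurd h hk
    have h2 : ∀ᵐ ω ∂P, ∀ l : ℤ, ∀ k : ℕ, 1 ≤ k → Γ 0 k (l +ᵥ ω) ≤ r :=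
      ae_all_iff.2 fun l => (measurePreserving_vadd l P).quasiMeasurePreserving.ae h1
    filter_upwards [h2, hshift] with ω h3 h4 l k hk
    rw [h4]
    exact h3 l k hk
  have hne : Λ.Nonempty := by
    by_contra hempty
    have h0 : P (⋃ n : ℕ, {ω | -(n : ℝ) ≤ Γ 0 1 ω}) = 0 := by
      refine measure_iUnion_null fun n => ?_
      by_contra h
      exact hempty ⟨-(n : ℝ), 1, le_rfl, h⟩
    have huniv : (⋃ n : ℕ, {ω | -(n : ℝ) ≤ Γ 0 1 ω}) = univ := by
      refine eq_univ_of_forall fun ω => mem_iUnion.2 ?_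
      obtain ⟨n, hn⟩ := exists_nat_ge (-Γ 0 1 ω)
      exact ⟨n, by rw [mem_ofPred_eq]; linarith⟩
    rw [huniv, measure_univ] at h0
    exact one_ne_zero h0
  have hbdd : BddAbove Λ := by
    by_contra hb
    have hall : ∀ n : ℕ, (n : ℝ) ∈ Λ := fun n => by
      obtain ⟨r, hr, hn⟩ := not_bddAbove_iff.1 hb n
      exact hdown r hr _ hn.le
    have h1 := ae_all_iff.2 fun n : ℕ => hlow n (hall n)
    -- The bound `M` depends on `ω`, but a single realization suffices for the contradiction.
    obtain ⟨ω, h2, ⟨δ, D, M, hδ0, hδ, -, hM⟩⟩ := (h1.and hbounds).exists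
    obtain ⟨n, hn⟩ := exists_nat_gt M
    obtain ⟨K, hK, hK1⟩ := ((h2 n).1.and (eventually_ge_atTop 1)).exists
    rw [hΓ] at hK
    have := dirichletEigenvalue_le (l := 0) (fun i => hδ0.trans_le (hδ i))
      (fun i => (le_abs_self _).trans (hM i)) hK1
    linarith
  have hinv : ∀ n : ℕ, 0 < 1 / ((n : ℝ) + 1) := fun n => Nat.one_div_pos_of_nat
  have hmem : ∀ n : ℕ, sSup Λ - 1 / ((n : ℝ) + 1) ∈ Λ := fun n => by
    obtain ⟨r, hr, hn⟩ := exists_lt_of_lt_csSup hne (sub_lt_self (sSup Λ) (hinv n))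
    exact hdown r hr _ hn.le
  have hnmem : ∀ n : ℕ, sSup Λ + 1 / ((n : ℝ) + 1) ∉ Λ := fun n h => by
    have := le_csSup hbdd h
    linarith [hinv n]
  refine ⟨sSup Λ, ?_, ?_⟩
  · filter_upwards [ae_all_iff.2 fun n => hlow _ (hmem n), ae_all_iff.2 fun n => hup _ (hnmem n),
      hmono] with ω h1 h2 h3
    refine ⟨tendsto_of_forall_nat (fun n => ?_) (fun n => ?_),
      tendsto_of_forall_nat (fun n => (h1 n).2) (fun n => ?_),
      tendsto_of_forall_nat (fun n => (h1 n).1) (fun n => ?_)⟩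
    · filter_upwards [(h1 n).1, eventually_ge_atTop 1] with K hK hK1
      exact hK.trans (h3 _ _ _ _ hK1 (by omega) (by omega))
    all_goals
      filter_upwards [eventually_ge_atTop 1] with K hK
      exact h2 n _ _ (by omega)
  · have hae : ∀ᵐ ω ∂P, ∀ p : ℝ,
        ((sSup Λ : ℝ) : EReal) ≤ lowerEigenvalue (fun i => d i ω) (fun i => c i ω) p := by
      choose k hk hk0 using hmem
      filter_upwards [ae_all_iff.2 fun n => ae_sublinear_dist (hnull (k n) (hk n) _) (hk0 n),
        hshift, hbounds] with ω h1 h2 ⟨δ, D, M, hδ0, hδ, hD, hM⟩ p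
      -- One `1 / (n + 1)` makes the level a member of `Λ`; the other is the margin that pays for
      -- the tails.
      have hle : ∀ n : ℕ, ((sSup Λ - 1 / ((n : ℝ) + 1) - 1 / ((n : ℝ) + 1) : ℝ) : EReal) ≤
          lowerEigenvalue (fun i => d i ω) (fun i => c i ω) p := by
        intro n
        refine le_lowerEigenvalue hδ hδ0 hD hM (sub_lt_self _ (hinv n)) (hk n) ?_ p
        simpa only [mem_ofPred_eq, ← h2, hΓ] using h1 n
      refine le_of_tendsto' (x := atTop) ?_ hle
      have hz := tendsto_one_div_add_atTop_nhds_zero_nat (𝕜 := ℝ)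
      have : Tendsto (fun n : ℕ => sSup Λ - 1 / ((n : ℝ) + 1) - 1 / ((n : ℝ) + 1)) atTop
          (𝓝 (sSup Λ)) := by
        simpa using (tendsto_const_nhds.sub hz).sub hz
      exact (continuous_coe_real_ereal.tendsto _).comp this
    -- The exceptional set need not be measurable, so a measurable null superset is removed.
    obtain ⟨A, hsub, hAm, hA0⟩ := exists_measurable_superset_of_null (ae_iff.1 hae)
    refine ⟨Aᶜ, hAm.compl, (prob_compl_eq_one_iff hAm).2 hA0, fun ω hω => ?_⟩
    by_contra h
    exact hω (hsub h)
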